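/- Let $K/F$ be a finite Galois extension of number fields with Galois group $G\neq 1$ (that is, $K\neq F$), let $\mathcal H$ be a set of nontrivial subgroups of $G$, and let $S$ be a finite $G$-stable set of nonzero prime ideals of $\mathcal O_K$. Put $$\mathcal O_{K,S}^\times=\{x\in K^\times \mid v_{\mathfrak P}(x)=0 \text{ for all nonzero primes } \mathfrak P\notin S\},$$ and for a subfield $L$ of $K$ containing $F$ let $\mathcal O_{L,S}^\times\subseteq L^\times$ be the group of $S'$-units of $L$, where $S'=\{L\cap\mathfrak P\mid \mathfrak P\in S\}$. Assume that at least one of the following holds: - $F$ is not totally real; - there is a real place of $F$ that splits completely in $K$ (all places of $K$ above it are real); - there is a nonzero prime ideal $\mathfrak p$ of $\mathcal O_F$ that splits completely in $K$ and such that all primes of $K$ above $\mathfrak p$ are in $S$. If the $\mathbb Z[G]$-submodule of $\mathcal O_{K,S}^\times$ generated by the groups $\mathcal O_{K^H,S}^\times$ for $H\in\mathcal H$ has finite index in $\mathcal O_{K,S}^\times$, then $G$ admits a norm relation with respect to $\mathcal H$: there are $\ell\ge 0$, elements $a_1,\dots,a_\ell,b_1,\dots,b_\ell\in\mathbb Q[G]$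 and nontrivial subgroups $H_1,\dots,H_\ell\in\mathcal H$ with $$1=\sum_{i=1}^{\ell} a_i N_{H_i} b_i \quad\text{in } \mathbb Q[G],\qquad N_H=\sum_{h\in H}h.$$ -/

import Mathlib

open NumberField IsDedekindDomain
open scoped Pointwise

noncomputable section

namespace NormRel

section GroupAlgebra

variable (R : Type*) [CommRing R] {G : Type*} [Group G] [Finite G]

/-- The norm element `N_H = ∑_{h ∈ H} h` of the group algebra `R[G]`. -/
def normElement (H : Subgroup G) : MonoidAlgebra R G :=
  ∑ h ∈ (Set.toFinite (H : Set G)).toFinset, MonoidAlgebra.of R G h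

/-- `G` admits a norm relation over `R` with respect to `𝓗`: an equality
`1 = ∑ i, a i * N_{H i} * b i` in `R[G]` with `H i ∈ 𝓗` and `H i` nontrivial. -/
def AdmitsNormRelation (𝓗 : Set (Subgroup G)) : Prop :=
  ∃ (l : ℕ) (a b : Fin l → MonoidAlgebra R G) (H : Fin l → Subgroup G),
    (∀ i, H i ∈ 𝓗 ∧ H i ≠ ⊥) ∧ 1 = ∑ i, a i * normElement R (H i) * b i

end GroupAlgebra

section Fields

variable (F K : Type*) [Field F] [NumberField F] [Field K] [NumberField K] [Algebra F K]

variable {K} in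
/-- A set of nonzero prime ideals of `𝓞 K` is stable under the action of `Gal(K/F)`. -/
def IsGaloisStable (S : Set (HeightOneSpectrum (𝓞 K))) : Prop :=
  ∀ (σ : K ≃ₐ[F] K) (P Q : HeightOneSpectrum (𝓞 K)),
    P ∈ S → Q.asIdeal = σ • P.asIdeal → Q ∈ S

variable {F} in
/-- A nonzero prime `p` of `F` splits completely in `K`: every prime of `K` above `p` has
ramification index and inertia degree one. -/
def PrimeSplitsCompletely (p : HeightOneSpectrum (𝓞 F)) : Prop :=
  ∀ P : HeightOneSpectrum (𝓞 K), P.asIdeal.LiesOver p.asIdeal →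
    P.asIdeal.ramificationIdx (𝓞 F) = 1 ∧ P.asIdeal.inertiaDeg (𝓞 F) = 1

variable {F} in
/-- A real place `v` of `F` that splits completely in `K`: `v` is real, and so is every place of
`K` above `v`. -/
def RealPlaceSplitsCompletely (v : InfinitePlace F) : Prop :=
  v.IsReal ∧ ∀ w : InfinitePlace K, w.comap (algebraMap F K) = v → w.IsReal

variable {F K}

/-- The set `{L ∩ P | P ∈ S}` of primes of the intermediate field `L`. -/
def primesBelow (S : Set (HeightOneSpectrum (𝓞 K))) (L : IntermediateField F K) :
    Set (HeightOneSpectrum (𝓞 L)) :=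
  {q | ∃ P ∈ S, q.asIdeal = P.asIdeal.comap (algebraMap (𝓞 L) (𝓞 K))}

/-- The group of `S`-units of the intermediate field `L`, as a subgroup of `Kˣ`. -/
def subfieldSUnits (S : Set (HeightOneSpectrum (𝓞 K))) (L : IntermediateField F K) :
    Subgroup Kˣ :=
  ((primesBelow S L).unit L).map (Units.map (algebraMap L K : L →* K))

variable (F K) in
/-- `Kˣ`, written additively, as a `ℤ[Gal(K/F)]`-module. -/
abbrev UnitsModule : Type _ :=
  (Representation.ofMulDistribMulAction (K ≃ₐ[F] K) Kˣ).asModule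

variable (F) in
/-- The element of the `ℤ[Gal(K/F)]`-module `Kˣ` given by `x`. -/
def toUnitsModule (x : Kˣ) : UnitsModule F K :=
  (Representation.ofMulDistribMulAction (K ≃ₐ[F] K) Kˣ).asModuleEquiv.symm (Additive.ofMul x)

/-- The `ℤ[G]`-submodule of `Kˣ` generated by the `S`-units of the fixed fields `K^H`,
`H ∈ 𝓗`, where `G = Gal(K/F)`. -/
def generatedModule (S : Set (HeightOneSpectrum (𝓞 K))) (𝓗 : Set (Subgroup (K ≃ₐ[F] K))) :
    Submodule (MonoidAlgebra ℤ (K ≃ₐ[F] K)) (UnitsModule F K) :=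
  Submodule.span (MonoidAlgebra ℤ (K ≃ₐ[F] K))
    {y | ∃ H ∈ 𝓗, ∃ x ∈ subfieldSUnits S (IntermediateField.fixedField H),
      y = toUnitsModule F x}

/-- The underlying subgroup of `Kˣ` of `generatedModule S 𝓗`. -/
def generatedSubgroup (S : Set (HeightOneSpectrum (𝓞 K))) (𝓗 : Set (Subgroup (K ≃ₐ[F] K))) :
    Subgroup Kˣ where
  carrier := {x | toUnitsModule F x ∈ generatedModule S 𝓗}
  one_mem' := (generatedModule S 𝓗).zero_mem
  mul_mem' hx hy := (generatedModule S 𝓗).add_mem hx hy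
  inv_mem' := by
    intro x hx
    have h := (generatedModule S 𝓗).smul_mem (algebraMap ℤ _ (-1))
      (show toUnitsModule F x ∈ _ from hx)
    have e : algebraMap ℤ (MonoidAlgebra ℤ (K ≃ₐ[F] K)) (-1) • toUnitsModule F x =
        toUnitsModule F x⁻¹ := by
      refine (Representation.asModuleEquiv_symm_map_smul _ (-1) (Additive.ofMul x)).symm.trans ?_
      simp [toUnitsModule]
    change toUnitsModule F x⁻¹ ∈ generatedModule S 𝓗
    rwa [e] at h

end Fields

end NormRel

end

/-! Without a norm relation, the two-sided ideal of `ℚ[G]` generated by the `N_H` misses `1`. A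
linear functional killing it but not `1`, scaled to integers, gives a nonconstant `a : G → ℤ` with
zero sum over every `c * H * k`. Then `∏ g, (g • u) ^ a g` is torsion on all conjugates of elements
of `K^H`, hence by finite index on all `S`-units. Each hypothesis on `F` provides a place of `K`
with trivial stabilizer. A unit that is small at every other infinite place then forces `a` to be
constant (`eq_of_twistedNorm_mem_torsion`); a generator of a power of the prime forces `a = 0`
(`eq_zero_of_twistedNorm_mem_torsion`). Both are contradictions. -/

namespace NormRel

/-! ### Functions on a finite group -/

section GroupFunctions

variable {G : Type*} [Group G] [Finite G]

/-- If `G` does not admit a norm relation over `ℚ` with respect to `𝓗`, then there is a nonconstant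
integer valued function on `G` whose sums over all translates of all `H ∈ 𝓗` vanish. -/
theorem exists_int_function_of_not_admitsNormRelation [Nontrivial G] {𝓗 : Set (Subgroup G)}
    (h𝓗 : ∀ H ∈ 𝓗, H ≠ ⊥) (hrel : ¬ AdmitsNormRelation ℚ 𝓗) :
    ∃ a : G → ℤ, (∃ g h, a g ≠ a h) ∧
      ∀ H ∈ 𝓗, ∀ c k : G, ∑ h ∈ (Set.toFinite (H : Set G)).toFinset, a (c * h * k) = 0 := by
  classical
  rcases 𝓗.eq_empty_or_nonempty with rfl | ⟨H₀, hH₀⟩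
  · obtain ⟨g, hg⟩ := exists_ne (1 : G)
    exact ⟨Pi.single 1 1, ⟨1, g, by simp [hg]⟩, by simp⟩
  -- The span of `s` is the two-sided ideal generated by the `N_H`.
  let s : Set (MonoidAlgebra ℚ G) := {x | ∃ H ∈ 𝓗, ∃ c k : G,
    x = MonoidAlgebra.of ℚ G c * normElement ℚ H * MonoidAlgebra.of ℚ G k}
  have hone : (1 : MonoidAlgebra ℚ G) ∉ Submodule.span ℚ s := by
    intro hmem
    obtain ⟨n, f, y, hy⟩ := Submodule.mem_span_set'.mp hmem
    choose H hH c k hx using fun i ↦ (y i).2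
    refine hrel ⟨n, fun i ↦ f i • MonoidAlgebra.of ℚ G (c i), fun i ↦ MonoidAlgebra.of ℚ G (k i), H,
      fun i ↦ ⟨hH i, h𝓗 _ (hH i)⟩, ?_⟩
    rw [← hy]
    refine Finset.sum_congr rfl fun i _ ↦ ?_
    rw [hx i, smul_mul_assoc, smul_mul_assoc]
  obtain ⟨φ, hφ1, hφ⟩ := Submodule.exists_le_ker_of_notMem hone
  have hsum : ∀ H ∈ 𝓗, ∀ c k : G, ∑ h ∈ (Set.toFinite (H : Set G)).toFinset,
      φ (MonoidAlgebra.of ℚ G (c * h * k)) = 0 := by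
    intro H hH c k
    have h0 := hφ (Submodule.subset_span (show _ ∈ s from ⟨H, hH, c, k, rfl⟩))
    rw [LinearMap.mem_ker, normElement, Finset.mul_sum, Finset.sum_mul, map_sum] at h0
    simpa only [map_mul] using h0
  obtain ⟨d, hd⟩ := IsLocalization.exist_integer_multiples_of_finite (nonZeroDivisors ℤ)
    (fun g : G ↦ φ (MonoidAlgebra.of ℚ G g))
  choose a ha using hd
  have hd0 : ((d : ℤ) : ℚ) ≠ 0 := by
    simp
  have ha' : ∀ g, (a g : ℚ) = (d : ℤ) * φ (MonoidAlgebra.of ℚ G g) := fun g ↦ by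
    simpa using ha g
  refine ⟨a, ?_, fun H hH c k ↦ ?_⟩
  -- If `a` were constant, the sum over `H₀` would be a nonzero multiple of `φ 1`.
  · by_contra! hconst
    have h0 := hsum H₀ hH₀ 1 1
    have hc : ∀ g, φ (MonoidAlgebra.of ℚ G g) = φ 1 := fun g ↦ by
      apply mul_left_cancel₀ hd0
      rw [← ha', hconst g 1, ha', map_one]
    simp only [hc, Finset.sum_const, smul_eq_zero, hφ1, or_false, Finset.card_eq_zero] at h0
    have : (1 : G) ∈ (Set.toFinite (H₀ : Set G)).toFinset := by simp [H₀.one_mem]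
    simp [h0] at this
  · have : ((∑ h ∈ (Set.toFinite (H : Set G)).toFinset, a (c * h * k) : ℤ) : ℚ) = 0 := by
      rw [Int.cast_sum]
      simp only [ha']
      rw [← Finset.mul_sum, hsum H hH, mul_zero]
    exact_mod_cast this

/-- A function on a finite group which is annihilated by the translates of a function that is
negative away from `1` and has nonnegative sum is constant. -/
theorem eq_of_sum_mul_eq_zero [Fintype G] {f x : G → ℝ} (hx : ∀ g ≠ 1, x g < 0) (hs : 0 ≤ ∑ g, x g)
    (hf : ∀ k, ∑ g, f g * x (g⁻¹ * k) = 0) (g h : G) : f g = f h := by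
  -- Maximum principle: the left side is `≤ 0` at a maximum of `f` and `≥ 0` at a minimum, while the
  -- right side is monotone in `f k`. So it vanishes at the maximum, term by term.
  have key : ∀ k, ∑ g, (f k - f g) * x (g⁻¹ * k) = f k * ∑ g, x g := by
    intro k
    simp only [sub_mul, Finset.sum_sub_distrib, hf, sub_zero, ← Finset.mul_sum]
    congr 1
    exact Fintype.sum_equiv ((Equiv.inv G).trans (Equiv.mulRight k)) _ _ fun _ ↦ rfl
  obtain ⟨k, hk⟩ := Finite.exists_max f
  obtain ⟨l, hl⟩ := Finite.exists_min f
  have hneg : ∀ k g, g ≠ k → x (g⁻¹ * k) < 0 := fun k g hgk ↦ hx _ fun h ↦ hgk <| by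
    rwa [inv_mul_eq_one] at h
  have h1 : ∀ g ∈ Finset.univ, (f k - f g) * x (g⁻¹ * k) ≤ 0 := by
    intro g _
    by_cases hgk : g = k
    · simp [hgk]
    · exact mul_nonpos_of_nonneg_of_nonpos (sub_nonneg.mpr (hk g)) (hneg k g hgk).le
  have h2 : 0 ≤ ∑ g, (f l - f g) * x (g⁻¹ * l) := by
    refine Finset.sum_nonneg fun g _ ↦ ?_
    by_cases hgl : g = l
    · simp [hgl]
    · exact mul_nonneg_of_nonpos_of_nonpos (sub_nonpos.mpr (hl g)) (hneg l g hgl).le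
  rw [key] at h2
  have h3 : ∑ g, (f k - f g) * x (g⁻¹ * k) = 0 := by
    refine le_antisymm (Finset.sum_nonpos h1) ?_
    rw [key]
    exact h2.trans (mul_le_mul_of_nonneg_right (hl k) hs)
  have h4 : ∀ g, f g = f k := by
    intro g
    by_cases hgk : g = k
    · rw [hgk]
    · have h5 := (Finset.sum_eq_zero_iff_of_nonpos h1).mp h3 g (Finset.mem_univ _)
      rcases mul_eq_zero.mp h5 with h | h
      · linarith
      · exact absurd h (hneg k g hgk).ne
  rw [h4 g, h4 h]

end GroupFunctions

/-! ### The endomorphism attached to an integer function -/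

section TwistedNorm

theorem prod_zpow_eq_zpow_sum {ι M : Type*} [CommGroup M] (s : Finset ι) (f : ι → ℤ) (v : M) :
    ∏ i ∈ s, v ^ f i = v ^ ∑ i ∈ s, f i := by
  classical
  induction s using Finset.induction_on with
  | empty => simp
  | insert i s hi ih => rw [Finset.prod_insert hi, Finset.sum_insert hi, zpow_add, ih]

variable {G : Type*} [Group G] [Fintype G] {M : Type*} [CommGroup M] [MulDistribMulAction G M]

/-- The endomorphism `u ↦ ∏ g, (g • u) ^ a g` of a commutative group with an action of `G`. -/
def twistedNorm (a : G → ℤ) : M →* M where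
  toFun u := ∏ g, (g • u) ^ a g
  map_one' := by simp
  map_mul' u v := by simp [mul_zpow, Finset.prod_mul_distrib]

theorem twistedNorm_apply (a : G → ℤ) (u : M) :
    twistedNorm a u = ∏ g, (g • u) ^ a g := rfl

/-- If the sums of `a` over all translates of `H` vanish, then the twisted norm attached to `a` is
torsion on all conjugates of the elements fixed by `H`. -/
theorem twistedNorm_smul_mem_torsion {a : G → ℤ} {H : Subgroup G}
    (ha : ∀ c k : G, ∑ h ∈ (Set.toFinite (H : Set G)).toFinset, a (c * h * k) = 0) {v : M}
    (hv : ∀ h ∈ H, h • v = v) (k : G) : twistedNorm a (k • v) ∈ CommGroup.torsion M := by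
  set T := (Set.toFinite (H : Set G)).toFinset
  have hT : ∀ h ∈ T, h ∈ H := by simp [T]
  have h1 : (1 : G) ∈ T := by simp [T, H.one_mem]
  refine isOfFinOrder_iff_pow_eq_one.mpr ⟨T.card, Finset.card_pos.mpr ⟨1, h1⟩, ?_⟩
  -- Substitute `g * k * h * k⁻¹` for `g`, using that `h` fixes `v`. In the product over all `h`,
  -- the exponent of `(g * k) • v` is a vanishing sum of `a`.
  have hshift : ∀ h ∈ T, twistedNorm a (k • v) = ∏ g, ((g * k) • v) ^ a (g * k * h * k⁻¹) := by
    intro h hh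
    rw [twistedNorm_apply]
    refine (Fintype.prod_equiv (Equiv.mulRight (k * h * k⁻¹)) _ _ fun g ↦ ?_).symm
    have : (g * (k * h * k⁻¹)) • k • v = (g * k) • v := by
      nth_rewrite 2 [← hv h (hT h hh)]
      simp only [smul_smul]
      group
    simp only [Equiv.coe_mulRight, this]
    simp only [mul_assoc]
  rw [← Finset.prod_const, Finset.prod_congr rfl hshift, Finset.prod_comm]
  refine Finset.prod_eq_one fun g _ ↦ ?_
  rw [prod_zpow_eq_zpow_sum, ha, zpow_zero]

end TwistedNorm

/-! ### Places with trivial stabilizer and the action on `S`-units -/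

section SUnits

variable {F K : Type*} [Field F] [Field K] [Algebra F K]

theorem smul_coe_units (σ : K ≃ₐ[F] K) (u : Kˣ) : ((σ • u : Kˣ) : K) = σ u := rfl

-- Any place above a complex place is unramified, so its stabilizer is trivial.
variable (K) in
theorem exists_infinitePlace_stabilizer_trivial_of_not_isTotallyReal [IsGalois F K]
    (hF : ¬ IsTotallyReal F) : ∃ w : InfinitePlace K, ∀ σ : K ≃ₐ[F] K, σ • w = w → σ = 1 := by
  obtain ⟨v, hv⟩ : ∃ v : InfinitePlace F, ¬ v.IsReal := by
    by_contra! h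
    exact hF ⟨h⟩
  obtain ⟨w, rfl⟩ := InfinitePlace.comap_surjective (K := K) v
  refine ⟨w, fun σ hσ ↦ ?_⟩
  have hw := (InfinitePlace.isUnramified_iff (k := F) (w := w)).mpr
    (Or.inr (InfinitePlace.not_isReal_iff_isComplex.mp hv))
  rw [← Subgroup.mem_bot, ← hw.stabilizer_eq_bot]
  exact hσ

theorem exists_infinitePlace_stabilizer_trivial_of_realPlaceSplitsCompletely [IsGalois F K]
    {v : InfinitePlace F} (hv : RealPlaceSplitsCompletely K v) :
    ∃ w : InfinitePlace K, ∀ σ : K ≃ₐ[F] K, σ • w = w → σ = 1 := by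
  obtain ⟨w, hw⟩ := InfinitePlace.comap_surjective (K := K) v
  refine ⟨w, fun σ hσ ↦ ?_⟩
  have hw := (InfinitePlace.isUnramified_iff (k := F) (w := w)).mpr (Or.inl (hv.2 w hw))
  rw [← Subgroup.mem_bot, ← hw.stabilizer_eq_bot]
  exact hσ

variable [NumberField K]

/-- If the primes `σ • P` are pairwise distinct and `P ∈ S`, then only the zero function has a
twisted norm that is torsion on `S`-units. -/
theorem eq_zero_of_twistedNorm_mem_torsion [Fintype (K ≃ₐ[F] K)]
    {S : Set (HeightOneSpectrum (𝓞 K))} {a : (K ≃ₐ[F] K) → ℤ}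
    (ha : ∀ u ∈ S.unit K, twistedNorm a u ∈ CommGroup.torsion Kˣ)
    {P : HeightOneSpectrum (𝓞 K)} (hP : P ∈ S)
    (hstab : ∀ σ : K ≃ₐ[F] K, σ • P.asIdeal = P.asIdeal → σ = 1) (k : K ≃ₐ[F] K) : a k = 0 := by
  -- The generator `x` is an `S`-unit whose only prime divisor is `P`.
  obtain ⟨x, hx⟩ : (P.asIdeal ^ classNumber K).IsPrincipal := by
    have h := pow_card_eq_one (x := ClassGroup.mk0
      ⟨P.asIdeal, mem_nonZeroDivisors_of_ne_zero P.ne_bot⟩)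
    rw [← map_pow, ClassGroup.mk0_eq_one_iff] at h
    exact h
  have hmem : ∀ Q : HeightOneSpectrum (𝓞 K), x ∈ Q.asIdeal ↔ P.asIdeal = Q.asIdeal := by
    intro Q
    have hn : classNumber K ≠ 0 := Fintype.card_ne_zero
    rw [← Ideal.span_singleton_le_iff_mem, Ideal.span, ← hx]
    refine ⟨fun h ↦ P.isMaximal.eq_of_le Q.isPrime.ne_top (Q.isPrime.le_of_pow_le h), fun h ↦ ?_⟩
    rw [← h]
    exact Ideal.pow_le_self hn
  have hx0 : (x : K) ≠ 0 := by
    intro h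
    have h0 : x = 0 := by exact_mod_cast h
    rw [h0] at hx
    exact pow_ne_zero _ P.ne_bot (by simpa using hx)
  have hu : Units.mk0 (x : K) hx0 ∈ S.unit K := by
    intro Q hQ
    refine (Q.valuation_eq_one_iff_notMem (K := K)).mpr fun h ↦ hQ ?_
    rwa [← HeightOneSpectrum.ext ((hmem Q).mp h)]
  have htor := ha _ hu
  let Q (σ : K ≃ₐ[F] K) : HeightOneSpectrum (𝓞 K) :=
    ⟨σ • P.asIdeal, inferInstance, fun h ↦ P.ne_bot <| by
      rw [← inv_smul_smul σ P.asIdeal, h, Ideal.smul_bot]⟩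
  have hval : ∀ g : K ≃ₐ[F] K, (Q k).valuation K (g x) < 1 ↔ g = k := by
    intro g
    have h1 : (g x : K) = ((g • x : 𝓞 K) : K) := rfl
    rw [h1, HeightOneSpectrum.valuation_lt_one_iff_mem]
    change g • x ∈ k • P.asIdeal ↔ _
    rw [← Ideal.mem_inv_pointwise_smul_iff, smul_smul]
    refine (hmem (Q (g⁻¹ * k))).trans ⟨fun h ↦ ?_, fun h ↦ ?_⟩
    · have := hstab (g⁻¹ * k) h.symm
      rwa [inv_mul_eq_one] at this
    · subst h
      simp [Q]
  obtain ⟨n, hn, hpow⟩ := isOfFinOrder_iff_pow_eq_one.mp htor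
  have h2 := congrArg (fun y : Kˣ ↦ (Q k).valuation K (y : K)) hpow
  simp only [twistedNorm_apply, Units.val_pow_eq_pow_val, map_pow, Units.coe_prod, map_prod,
    Units.val_one, map_one, Units.val_zpow_eq_zpow_val, map_zpow₀, smul_coe_units,
    Units.val_mk0] at h2
  -- At the prime `k • P`, only the factor `g = k` has nontrivial valuation.
  rw [Finset.prod_eq_single k] at h2
  · by_contra hk
    have h3 := (hval k).mpr rfl
    rw [← zpow_natCast, ← zpow_mul, zpow_eq_one_iff_right₀ zero_le h3.ne] at h2
    simp [hk, hn.ne'] at h2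
  · intro g _ hg
    have h3 : (Q k).valuation K (g x) = 1 := by
      refine le_antisymm ((Q k).valuation_le_one (g • x : 𝓞 K)) ?_
      rw [← not_lt, hval]
      exact hg
    rw [h3, one_zpow]
  · simp

/-- If the places `σ • w` are pairwise distinct, then only constant functions have a twisted norm
that is torsion on units. -/
theorem eq_of_twistedNorm_mem_torsion [Fintype (K ≃ₐ[F] K)] {a : (K ≃ₐ[F] K) → ℤ}
    (ha : ∀ u : (𝓞 K)ˣ, twistedNorm a (Units.map (algebraMap (𝓞 K) K : 𝓞 K →* K) u) ∈
      CommGroup.torsion Kˣ)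
    {w : InfinitePlace K} (hw : ∀ σ : K ≃ₐ[F] K, σ • w = w → σ = 1) (g h : K ≃ₐ[F] K) :
    a g = a h := by
  classical
  obtain ⟨u, hu⟩ := Units.dirichletUnitTheorem.exists_unit K w
  let x : (K ≃ₐ[F] K) → ℝ := fun σ ↦ Real.log ((σ • w) (u : K))
  have hinj : Function.Injective fun σ : K ≃ₐ[F] K ↦ σ • w := by
    intro σ τ hστ
    have := hw (σ⁻¹ * τ) (by rw [mul_smul, inv_smul_eq_iff]; exact hστ.symm)
    rwa [inv_mul_eq_one] at this
  have hneg : ∀ σ ≠ 1, x σ < 0 := fun σ hσ ↦ hu _ fun h ↦ hσ (hw σ h)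
  -- By the product formula: places outside the orbit of `w` contribute at most `0`, and those in
  -- the orbit share one multiplicity.
  have hsum : 0 ≤ ∑ σ, x σ := by
    have h0 := Units.sum_mult_mul_log u
    have hmult : ∀ σ : K ≃ₐ[F] K, (σ • w).mult = w.mult := fun σ ↦ by
      simp only [InfinitePlace.mult, InfinitePlace.isReal_smul_iff]
    rw [← Finset.sum_add_sum_compl (Finset.univ.image fun σ : K ≃ₐ[F] K ↦ σ • w),
      Finset.sum_image fun σ _ τ _ h ↦ hinj h] at h0
    have h1 : ∑ v ∈ (Finset.univ.image fun σ : K ≃ₐ[F] K ↦ σ • w)ᶜ,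
        (v.mult : ℝ) * Real.log (v (u : K)) ≤ 0 := by
      refine Finset.sum_nonpos fun v hv ↦ mul_nonpos_of_nonneg_of_nonpos (by positivity) ?_
      refine (hu v ?_).le
      rintro rfl
      simp only [Finset.mem_compl, Finset.mem_image, Finset.mem_univ, true_and, not_exists] at hv
      exact hv 1 (one_smul _ _)
    simp only [hmult, ← Finset.mul_sum] at h0
    have h2 : 0 ≤ (w.mult : ℝ) * ∑ σ, x σ := by simp only [x]; linarith
    exact nonneg_of_mul_nonneg_right h2 (by exact_mod_cast InfinitePlace.mult_pos)
  -- Torsion has absolute value `1` at `k • w`, and `(k • w) (σ u) = ((σ⁻¹ * k) • w) u`.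
  have hf : ∀ k, ∑ σ, (a σ : ℝ) * x (σ⁻¹ * k) = 0 := by
    intro k
    obtain ⟨n, hn, hpow⟩ := isOfFinOrder_iff_pow_eq_one.mp (ha u)
    have h2 := congrArg (fun y : Kˣ ↦ Real.log ((k • w) (y : K))) hpow
    simp only [twistedNorm_apply, Units.val_pow_eq_pow_val, map_pow, Units.coe_prod, map_prod,
      Units.val_one, map_one, Units.val_zpow_eq_zpow_val, map_zpow₀, smul_coe_units,
      Real.log_pow, Real.log_one, mul_eq_zero, Nat.cast_eq_zero, hn.ne', false_or] at h2
    rw [Real.log_prod] at h2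
    · rw [← h2]
      refine Finset.sum_congr rfl fun σ _ ↦ ?_
      rw [Real.log_zpow]
      rfl
    · intro σ _
      refine zpow_ne_zero _ ?_
      simp
  exact_mod_cast eq_of_sum_mul_eq_zero hneg hsum hf g h

variable [NumberField F]

/-- If `generatedSubgroup S 𝓗` has finite index in the `S`-units and the sums of `a` over all
translates of all `H ∈ 𝓗` vanish, then the twisted norm attached to `a` is torsion on `S`-units. -/
theorem twistedNorm_mem_torsion_of_isFiniteRelIndex [Fintype (K ≃ₐ[F] K)]
    {S : Set (HeightOneSpectrum (𝓞 K))} {𝓗 : Set (Subgroup (K ≃ₐ[F] K))}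
    (hindex : (generatedSubgroup S 𝓗).IsFiniteRelIndex (S.unit K)) {a : (K ≃ₐ[F] K) → ℤ}
    (ha : ∀ H ∈ 𝓗, ∀ c k : K ≃ₐ[F] K,
      ∑ h ∈ (Set.toFinite (H : Set (K ≃ₐ[F] K))).toFinset, a (c * h * k) = 0)
    {u : Kˣ} (hu : u ∈ S.unit K) : twistedNorm a u ∈ CommGroup.torsion Kˣ := by
  let e : UnitsModule F K → Kˣ := fun y ↦
    ((Representation.ofMulDistribMulAction (K ≃ₐ[F] K) Kˣ).asModuleEquiv y).toMul
  have he : ∀ v, e (toUnitsModule F v) = v := fun v ↦ rfl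
  have hadd : ∀ x y, e (x + y) = e x * e y := fun x y ↦ rfl
  have hof : ∀ (g : K ≃ₐ[F] K) y, e (MonoidAlgebra.of ℤ _ g • y) = g • e y := by
    intro g y
    simp only [e, Representation.asModuleEquiv_map_smul, MonoidAlgebra.of_apply,
      Representation.asAlgebraHom_single_one]
    rfl
  -- The twisted norm need not be equivariant; quantifying over `k` lets the induction absorb group
  -- elements from the scalars.
  have hgen : ∀ y ∈ generatedModule S 𝓗, ∀ k : K ≃ₐ[F] K,
      twistedNorm a (k • e y) ∈ CommGroup.torsion Kˣ := by
    intro y hy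
    induction hy using Submodule.span_induction with
    | mem y hy =>
      obtain ⟨H, hH, _, ⟨w, -, rfl⟩, hy⟩ := hy
      rw [hy, he]
      refine twistedNorm_smul_mem_torsion (ha H hH) fun h hh ↦ ?_
      ext
      exact w.val.2 ⟨h, hh⟩
    | zero => simp [e]
    | add x y _ _ hx hy =>
      intro k
      rw [hadd, smul_mul', map_mul]
      exact mul_mem (hx k) (hy k)
    | smul r x _ hx =>
      induction r using MonoidAlgebra.induction_on with
      | of g =>
        intro k
        rw [hof, smul_smul]
        exact hx _
      | add p q hp hq =>
        intro k
        rw [add_smul, hadd, smul_mul', map_mul]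
        exact mul_mem (hp k) (hq k)
      | smul n p hp =>
        intro k
        have : e ((n • p) • x) = e (p • x) ^ n := by
          simp [e, Representation.asModuleEquiv_map_smul]
        rw [this, smul_zpow', map_zpow]
        exact zpow_mem (hp k) n
  obtain ⟨n, hn, -, hmem⟩ := Subgroup.exists_pow_mem_of_relIndex_ne_zero hindex.1 hu
  have h1 := hgen _ hmem.1 1
  change twistedNorm a ((1 : K ≃ₐ[F] K) • u ^ n) ∈ _ at h1
  rw [one_smul, map_pow] at h1
  exact (isOfFinOrder_pow.mp h1).resolve_right hn.ne'

/-- With `e = f = 1` the orbit of primes above `p` has as many elements as the group, so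
orbit–stabilizer applies. -/
theorem exists_prime_stabilizer_trivial_of_primeSplitsCompletely [IsGalois F K]
    {p : HeightOneSpectrum (𝓞 F)} (hp : PrimeSplitsCompletely K p) :
    ∃ P : HeightOneSpectrum (𝓞 K), P.asIdeal.LiesOver p.asIdeal ∧
      ∀ σ : K ≃ₐ[F] K, σ • P.asIdeal = P.asIdeal → σ = 1 := by
  obtain ⟨⟨P, hP, hPp⟩⟩ := (inferInstance : Nonempty (p.asIdeal.primesOver (𝓞 K)))
  have hPbot : P ≠ ⊥ := Ideal.ne_bot_of_liesOver_of_ne_bot p.ne_bot P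
  refine ⟨⟨P, hP, hPbot⟩, hPp, fun σ hσ ↦ ?_⟩
  obtain ⟨he, hf⟩ := hp ⟨P, hP, hPbot⟩ hPp
  have hcard := Ideal.ncard_primesOver_mul_ramificationIdxIn_mul_inertiaDegIn p.asIdeal (𝓞 K)
    (K ≃ₐ[F] K)
  rw [Ideal.ramificationIdxIn_eq_ramificationIdx p.asIdeal P (K ≃ₐ[F] K),
    Ideal.inertiaDegIn_eq_inertiaDeg p.asIdeal P (K ≃ₐ[F] K), he, hf, mul_one, mul_one,
    ← Algebra.IsInvariant.orbit_eq_primesOver (𝓞 F) (𝓞 K) (K ≃ₐ[F] K) p.asIdeal P,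
    ← MulAction.index_stabilizer] at hcard
  have hmul := (MulAction.stabilizer (K ≃ₐ[F] K) P).card_mul_index
  rw [hcard] at hmul
  have h1 : Nat.card (MulAction.stabilizer (K ≃ₐ[F] K) P) = 1 :=
    Nat.eq_of_mul_eq_mul_right Nat.card_pos (hmul.trans (one_mul _).symm)
  rw [← Subgroup.mem_bot, ← Subgroup.card_eq_one.mp h1]
  exact hσ

end SUnits

end NormRel

theorem mainTheorem10 (F K : Type*) [Field F] [NumberField F] [Field K] [NumberField K]
    [Algebra F K] [IsGalois F K] [Nontrivial (K ≃ₐ[F] K)]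
    (𝓗 : Set (Subgroup (K ≃ₐ[F] K))) (h𝓗 : ∀ H ∈ 𝓗, H ≠ ⊥)
    (S : Set (HeightOneSpectrum (𝓞 K))) (hfin : S.Finite) (hS : NormRel.IsGaloisStable F S)
    (hcond : ¬ NumberField.IsTotallyReal F ∨
      (∃ v : InfinitePlace F, NormRel.RealPlaceSplitsCompletely K v) ∨
      (∃ p : HeightOneSpectrum (𝓞 F), NormRel.PrimeSplitsCompletely K p ∧
        ∀ P : HeightOneSpectrum (𝓞 K), P.asIdeal.LiesOver p.asIdeal → P ∈ S))
    (hindex : (NormRel.generatedSubgroup S 𝓗).IsFiniteRelIndex (S.unit K)) :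
    NormRel.AdmitsNormRelation ℚ 𝓗 := by
  by_contra hrel
  obtain ⟨a, ⟨g, h, hgh⟩, ha⟩ :=
    NormRel.exists_int_function_of_not_admitsNormRelation h𝓗 hrel
  have := Fintype.ofFinite (K ≃ₐ[F] K)
  have htor : ∀ u ∈ S.unit K, NormRel.twistedNorm a u ∈ CommGroup.torsion Kˣ := fun u hu ↦
    NormRel.twistedNorm_mem_torsion_of_isFiniteRelIndex hindex ha hu
  have hunits : ∀ u : (𝓞 K)ˣ, NormRel.twistedNorm a
      (Units.map (algebraMap (𝓞 K) K : 𝓞 K →* K) u) ∈ CommGroup.torsion Kˣ := fun u ↦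
    htor _ fun Q _ ↦ (Q.valuation_eq_one_iff_notMem (K := K)).mpr fun hmem ↦
      Q.isPrime.ne_top (Ideal.eq_top_of_isUnit_mem _ hmem u.isUnit)
  rcases hcond with hF | ⟨v, hv⟩ | ⟨p, hp, hpS⟩
  · obtain ⟨w, hw⟩ := NormRel.exists_infinitePlace_stabilizer_trivial_of_not_isTotallyReal K hF
    exact hgh (NormRel.eq_of_twistedNorm_mem_torsion hunits hw g h)
  · obtain ⟨w, hw⟩ :=
      NormRel.exists_infinitePlace_stabilizer_trivial_of_realPlaceSplitsCompletely hv
    exact hgh (NormRel.eq_of_twistedNorm_mem_torsion hunits hw g h)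
  · obtain ⟨P, hP, hstab⟩ :=
      NormRel.exists_prime_stabilizer_trivial_of_primeSplitsCompletely hp
    have h0 := NormRel.eq_zero_of_twistedNorm_mem_torsion htor (hpS P hP) hstab
    exact hgh ((h0 g).trans (h0 h).symm)
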